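/- Let $\kappa$ be a regular uncountable cardinal, and write $[\kappa]^2=\{(\alpha,\beta)\mid\alpha<\beta<\kappa\}$; for sets of ordinals $a,b$, write $a<b$ if $\alpha<\beta$ for all $\alpha\in a$ and $\beta\in b$. Suppose that $\mathrm{pl}_1(\kappa)$ holds, that is, there exists a transformation $\mathbf t:[\kappa]^2\to[\kappa]^2$ such that: (i) for every $(\alpha,\beta)\in[\kappa]^2$, if $\mathbf t(\alpha,\beta)=(\alpha^*,\beta^*)$, then $\alpha^*\le\alpha<\beta^*\le\beta$; (ii) for every family $\mathcal A$ consisting of $\kappa$ many pairwise disjoint finite subsets of $\kappa$, there exists a stationary set $S\subseteq\kappa$ such that, for every pair $\alpha^*<\beta^*$ of elements of $S$, there exists a pair $a<b$ of elements of $\mathcal A$ with $\mathbf t[a\times b]=\{(\alpha^*,\beta^*)\}$. Then, for every positive integer $n$, there exists a poset $\mathbb P$ such that $\mathbb P^n$ satisfies the $\kappa$-cc but $\mathbb P^{n+1}$ does not. Here $\mathbb P^m$ carries the coordinatewise order, and a poset satisfies the $\kappa$-cc if every set of pairwise incompatible elements (no two distinct ones having a common lower bound) has cardinality less than $\kappa$.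 -/

import Mathlib

open Cardinal

universe u

/-- `t` is a transformation of `[κ]²` into `[κ]²` witnessing `pl₁(κ)`. The ordinal `κ` is
represented by `κ.ord.ToType`, the well-order of order type `κ`. Only the values `t (α, β)` with
`α < β` play a role, so that `t` may be total. -/
structure IsPlOneWitness (κ : Cardinal.{u})
    (t : κ.ord.ToType × κ.ord.ToType → κ.ord.ToType × κ.ord.ToType) : Prop where
  /-- If `t (α, β) = (α', β')`, then `α' ≤ α < β' ≤ β` (in particular, `α' < β'`). -/
  location : ∀ α β : κ.ord.ToType, α < β →
    (t (α, β)).1 ≤ α ∧ α < (t (α, β)).2 ∧ (t (α, β)).2 ≤ β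
  /-- For every family of `κ` many pairwise disjoint finite subsets of `κ` there is a stationary
  set `S` such that all pairs `α < β` of elements of `S` are captured by a pair `a < b` of members
  of the family, where `a < b` means that every element of `a` is below every element of `b`. -/
  capture : ∀ A : Set (Finset κ.ord.ToType), #A = κ → A.PairwiseDisjoint id →
    ∃ S : Set κ.ord.ToType, IsStationary S ∧
      ∀ α ∈ S, ∀ β ∈ S, α < β →
        ∃ a ∈ A, ∃ b ∈ A, (∀ x ∈ a, ∀ y ∈ b, x < y) ∧
          t '' ((a : Set κ.ord.ToType) ×ˢ (b : Set κ.ord.ToType)) = {(α, β)}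

/-- The principle `pl₁(κ)`. -/
def PlOne (κ : Cardinal.{u}) : Prop :=
  ∃ t : κ.ord.ToType × κ.ord.ToType → κ.ord.ToType × κ.ord.ToType, IsPlOneWitness κ t

/-- The `κ`-chain condition: every set of pairwise incompatible elements (no two distinct members
have a common lower bound) has cardinality less than `κ`. -/
def SatisfiesCC (κ : Cardinal.{u}) (P : Type u) [PartialOrder P] : Prop :=
  ∀ A : Set P, IsStrongAntichain (· ≥ ·) A → #A < κ

/-!
# Posets whose `n`-th power is `κ`-cc while the `(n + 1)`-st is not, from `pl₁(κ)`

**The coloring.** Let `t` witness `pl₁(κ)`. Neither coordinate increases under `t`, so the iterates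
of `t` at a pair `p` reach a fixed point after finitely many steps; let `d p` be their number. If a
stationary set `S` is captured by a family `A`, then every non-fixed `p ∈ [S]²` is the constant
value of `t` on some rectangle `a × b`, on which `d` is then constantly `d p + 1`. The claim
(`exists_rectangular_coloring`) is that, for each `N > 0`, the coloring `d mod N` is constant with
any prescribed value on some rectangle from any given family. Suppose that the value `i` is omitted
by a family. Passing to captured sets repeatedly yields stationary sets `S 0, S 1, …` such that the
non-fixed pairs from `S k` omit the residue `i - (k + 1)`. Take a disjoint family of finite sets
each of which meets all of `S 0, …, S (N - 1)`. It captures a stationary set, which contains a pair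
`p` that is not fixed (`IsPlOneWitness.exists_ne`), and some preimage of `p` lies in `[S k]²` for
every `k < N`. As all these preimages have the same depth `d p + 1`, this depth omits all residues
modulo `N`, which is absurd.

**The poset.** Fix such a coloring `c` with `n + 1` colors. A condition is a color `i` and a finite
set on which `c` omits `i`; conditions of different colors are incompatible. The tuples
`((0, {α}), …, (n, {α}))` form an antichain of size `κ` in the `(n + 1)`-st power, since `{α, β}` is
not a condition of color `c α β`. Given `κ` many elements of the `n`-th power, one may assume that
they use the same colors and that their supports form a Δ-system (`exists_deltaSystem`) with the
same traces on the root. Some color is used by none of the `n` coordinates, and a rectangle of that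
color gives two elements whose coordinatewise unions are conditions.
-/

/-! ### Disjoint families and Δ-systems -/

theorem exists_maximal_pairwiseDisjoint {ι α : Type*} (f : ι → Finset α) (I : Set ι) :
    ∃ J ⊆ I, J.PairwiseDisjoint f ∧ ∀ i ∈ I, i ∉ J → ∃ j ∈ J, ¬ Disjoint (f i) (f j) := by
  obtain ⟨J, hJ⟩ := zorn_subset {J : Set ι | J ⊆ I ∧ J.PairwiseDisjoint f} (by
    intro C hC hchain
    refine ⟨⋃₀ C, ⟨Set.sUnion_subset fun s hs => (hC hs).1, ?_⟩,
      fun s hs => Set.subset_sUnion_of_mem hs⟩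
    exact (Set.pairwiseDisjoint_sUnion hchain.directedOn).2 fun s hs => (hC hs).2)
  refine ⟨J, hJ.prop.1, hJ.prop.2, fun i hi hiJ => ?_⟩
  by_contra! h
  refine hiJ (hJ.le_of_ge (y := insert i J) ⟨Set.insert_subset hi hJ.prop.1, ?_⟩
    (Set.subset_insert i J) (Set.mem_insert i J))
  exact hJ.prop.2.insert fun j hj _ => h j hj

theorem mk_biUnion_finset_lt {ι α : Type u} {κ : Cardinal.{u}} (hreg : κ.IsRegular)
    (hunc : ℵ₀ < κ) (f : ι → Finset α) {J : Set ι} (hJ : #J < κ) :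
    #(⋃ j ∈ J, (f j : Set α) : Set α) < κ :=
  (card_biUnion_lt_iff_forall_of_isRegular hreg hJ).2 fun _ _ =>
    (Cardinal.lt_aleph0_of_finite _).trans hunc

/-- The Δ-system lemma for indexed families of finite sets of bounded size. -/
theorem exists_deltaSystem_of_card_le {ι α : Type u} [DecidableEq α] {κ : Cardinal.{u}}
    (hreg : κ.IsRegular) (hunc : ℵ₀ < κ) (m : ℕ) (f : ι → Finset α) (I : Set ι) (hI : κ ≤ #I)
    (hf : ∀ i ∈ I, (f i).card ≤ m) :
    ∃ J ⊆ I, κ ≤ #J ∧ ∃ r : Finset α, J.PairwiseDisjoint fun j => f j \ r := by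
  induction m generalizing f I with
  | zero =>
    refine ⟨I, subset_rfl, hI, ∅, fun i hi j hj _ => ?_⟩
    have : f i = ∅ := Finset.card_eq_zero.1 (Nat.le_zero.1 (hf i hi))
    simp [Function.onFun, this]
  | succ m ih =>
    obtain ⟨J, hJI, hJ, hmax⟩ := exists_maximal_pairwiseDisjoint f I
    by_cases hJκ : κ ≤ #J
    · exact ⟨J, hJI, hJκ, ∅, by simpa using hJ⟩
    rw [not_le] at hJκ
    -- A small maximal disjoint subfamily has a small union, which all other members meet.
    have hU := mk_biUnion_finset_lt hreg hunc f hJκ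
    set U : Set α := ⋃ j ∈ J, (f j : Set α)
    have hmeet : ∀ i : ↥(I \ J), ∃ u : U, (u : α) ∈ f i := by
      rintro ⟨i, hi, hiJ⟩
      obtain ⟨j, hj, hij⟩ := hmax i hi hiJ
      obtain ⟨u, hui, huj⟩ := Finset.not_disjoint_iff.1 hij
      exact ⟨⟨u, Set.mem_biUnion hj huj⟩, hui⟩
    choose g hg using hmeet
    have hIJ : κ ≤ #↥(I \ J) := by
      by_contra! h
      refine (hI.trans ((Cardinal.mk_le_mk_of_subset (?_ : I ⊆ I \ J ∪ J)).trans
        (Cardinal.mk_union_le _ _))).not_gt (Cardinal.add_lt_of_lt hreg.aleph0_le h hJκ)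
      simp
    obtain ⟨u, I', hI', hκ', hu⟩ := Cardinal.infinite_pigeonhole_set g κ hIJ hreg.aleph0_le
      (by rwa [hreg.cof_ord])
    have hmem : ∀ i ∈ I', (u : α) ∈ f i := fun i hi => hu hi ▸ hg ⟨i, hI' hi⟩
    obtain ⟨K, hKI, hK, r, hr⟩ := ih (fun i => (f i).erase u) I' hκ' fun i hi => by
      have := hf i (hI' hi).1
      rw [Finset.card_erase_of_mem (hmem i hi)]
      omega
    refine ⟨K, fun i hi => (hI' (hKI hi)).1, hK, insert ↑u r, ?_⟩
    convert hr using 2 with i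
    ext x
    simp only [Finset.mem_sdiff, Finset.mem_insert, Finset.mem_erase]
    tauto

/-- The Δ-system lemma for indexed families of finite sets. The members need not contain `r`: what
is needed is only that any two of them intersect inside `r`. -/
theorem exists_deltaSystem {ι α : Type u} [DecidableEq α] {κ : Cardinal.{u}}
    (hreg : κ.IsRegular) (hunc : ℵ₀ < κ) (f : ι → Finset α) (I : Set ι) (hI : κ ≤ #I) :
    ∃ J ⊆ I, κ ≤ #J ∧ ∃ r : Finset α, J.PairwiseDisjoint fun j => f j \ r := by
  obtain ⟨⟨m⟩, I', hI', hκ', hm⟩ := Cardinal.infinite_pigeonhole_set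
    (fun i : I => ULift.up.{u} (f i).card) κ hI hreg.aleph0_le (by simpa [hreg.cof_ord])
  obtain ⟨J, hJ, h⟩ := exists_deltaSystem_of_card_le hreg hunc m f I' hκ'
    fun i hi => (congrArg ULift.down (hm hi)).le
  exact ⟨J, hJ.trans hI', h⟩

theorem exists_pairwiseDisjoint_mk_eq {κ : Cardinal.{u}} (hreg : κ.IsRegular) (hunc : ℵ₀ < κ)
    (B : Set (Finset κ.ord.ToType))
    (hB : ∀ δ : κ.ord.ToType, ∃ b ∈ B, b.Nonempty ∧ ∀ x ∈ b, δ < x) :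
    ∃ A ⊆ B, #A = κ ∧ A.PairwiseDisjoint id := by
  have hcard : #(Finset κ.ord.ToType) = κ := by
    have : Infinite κ.ord.ToType := by
      rw [Cardinal.infinite_iff, Cardinal.mk_ord_toType]
      exact hreg.aleph0_le
    rw [Cardinal.mk_finset_of_infinite, Cardinal.mk_ord_toType]
  obtain ⟨A, hAB, hA, hmax⟩ := exists_maximal_pairwiseDisjoint id B
  refine ⟨A, hAB, le_antisymm ((Cardinal.mk_set_le A).trans hcard.le) ?_, hA⟩
  by_contra! hlt
  have hU := mk_biUnion_finset_lt hreg hunc id hlt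
  obtain ⟨δ, hδ⟩ := not_isCofinal_iff.1 fun h : IsCofinal (⋃ a ∈ A, (id a : Set κ.ord.ToType)) =>
    (Order.cof_le h).not_gt (by rwa [Ordinal.cof_toType, hreg.cof_ord])
  obtain ⟨b, hb, ⟨x, hx⟩, hbδ⟩ := hB δ
  have hlt_of_mem : ∀ a ∈ A, ∀ y ∈ a, y < δ := fun a ha y hy => hδ y (Set.mem_biUnion ha hy)
  obtain ⟨a, ha, hab⟩ := hmax b hb fun hbA => (hlt_of_mem b hbA x hx).not_gt (hbδ x hx)
  obtain ⟨y, hyb, hya⟩ := Finset.not_disjoint_iff.1 hab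
  exact (hlt_of_mem a ha y hya).not_gt (hbδ y hyb)

theorem exists_gt_of_isStationary {α : Type*} [LinearOrder α] [NoMaxOrder α] {S : Set α}
    (hS : IsStationary S) (δ : α) : ∃ x ∈ S, δ < x := by
  refine hS (t := Set.Ioi δ) ⟨?_, fun a => ?_⟩
  · intro s hs ⟨x, hx⟩ _ a ha
    exact (hs hx).trans_le (ha.1 hx)
  · obtain ⟨b, hb⟩ := exists_gt (max a δ)
    exact ⟨b, (le_max_right a δ).trans_lt hb, ((le_max_left a δ).trans_lt hb).le⟩

/-! ### The depth coloring -/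

/-- The depth `d x` counts the applications of `f` that lead from `x` to a fixed point. -/
theorem exists_depth {α : Type*} [PartialOrder α] [WellFoundedLT α] (f : α → α)
    (hf : ∀ x, f x ≤ x) : ∃ d : α → ℕ, ∀ x, f x ≠ x → d x = d (f x) + 1 := by
  classical
  refine ⟨wellFounded_lt.fix fun x d =>
    if h : f x ≠ x then d (f x) (lt_of_le_of_ne (hf x) h) + 1 else 0, fun x hx => ?_⟩
  rw [WellFounded.fix_eq, dif_pos hx]

namespace IsPlOneWitness

variable {κ : Cardinal.{u}} {t : κ.ord.ToType × κ.ord.ToType → κ.ord.ToType × κ.ord.ToType}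

theorem exists_depth (ht : IsPlOneWitness κ t) : ∃ d : κ.ord.ToType × κ.ord.ToType → ℕ,
    ∀ x y : κ.ord.ToType, x < y → t (x, y) ≠ (x, y) → d (x, y) = d (t (x, y)) + 1 := by
  classical
  obtain ⟨d, hd⟩ := _root_.exists_depth
    (fun p : κ.ord.ToType × κ.ord.ToType => if p.1 < p.2 then t p else p) fun p => by
    split_ifs with h
    · obtain ⟨h₁, -, h₂⟩ := ht.location p.1 p.2 h
      exact ⟨h₁, h₂⟩
    · exact le_rfl
  refine ⟨d, fun x y hxy hne => ?_⟩
  simpa [hxy] using hd (x, y) (by simpa [hxy] using hne)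

/-- A witness of `pl₁(κ)` does not fix all pairs from an unbounded set, because it has to be constant
on the rectangle spanned by two finite sets with several elements. -/
theorem exists_ne (ht : IsPlOneWitness κ t) (hreg : κ.IsRegular) (hunc : ℵ₀ < κ)
    {S : Set κ.ord.ToType} (hS : ∀ δ, ∃ x ∈ S, δ < x) :
    ∃ x ∈ S, ∃ y ∈ S, x < y ∧ t (x, y) ≠ (x, y) := by
  classical
  obtain ⟨A, hAB, hA, hdisj⟩ := exists_pairwiseDisjoint_mk_eq hreg hunc
    {b | ↑b ⊆ S ∧ ∃ x ∈ b, ∃ x' ∈ b, x ≠ x'} fun δ => by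
      obtain ⟨x, hx, hδx⟩ := hS δ
      obtain ⟨x', hx', hxx'⟩ := hS x
      refine ⟨{x, x'}, ⟨by simp [Set.insert_subset_iff, hx, hx'], x, by simp, x', by simp,
        hxx'.ne⟩, by simp, ?_⟩
      simp [hδx, hδx.trans hxx']
  obtain ⟨T, hT, hcap⟩ := ht.capture A hA hdisj
  have : NoMaxOrder κ.ord.ToType := Cardinal.noMaxOrder hreg.aleph0_le
  obtain ⟨α, hα⟩ := hT.nonempty
  obtain ⟨β, hβ, hαβ⟩ := exists_gt_of_isStationary hT α
  obtain ⟨a, ha, b, hb, hab, himg⟩ := hcap α hα β hβ hαβ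
  obtain ⟨haS, x, hx, x', hx', hne⟩ := hAB ha
  obtain ⟨hbS, y, hy, -⟩ := hAB hb
  have heq : ∀ z ∈ a, t (z, y) = (α, β) := fun z hz =>
    himg.subset (Set.mem_image_of_mem t (Set.mk_mem_prod hz hy))
  -- `t` identifies the distinct pairs `(x, y)` and `(x', y)`, so it does not fix both.
  by_cases h : t (x, y) = (x, y)
  · refine ⟨x', haS hx', y, hbS hy, hab x' hx' y hy, fun h' => hne ?_⟩
    exact congrArg Prod.fst (h.symm.trans ((heq x hx).trans ((heq x' hx').symm.trans h')))
  · exact ⟨x, haS hx, y, hbS hy, hab x hx y hy, h⟩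

/-- For every residue `i` modulo `N`, any family of `κ` many pairwise disjoint finite sets spans a
rectangle on which the depth `d` is constantly congruent to `i`. -/
theorem exists_rectangle_depth_mod (ht : IsPlOneWitness κ t) (hreg : κ.IsRegular) (hunc : ℵ₀ < κ)
    {d : κ.ord.ToType × κ.ord.ToType → ℕ}
    (hd : ∀ x y : κ.ord.ToType, x < y → t (x, y) ≠ (x, y) → d (x, y) = d (t (x, y)) + 1)
    {A : Set (Finset κ.ord.ToType)} (hA : #A = κ) (hdisj : A.PairwiseDisjoint id)
    {N i : ℕ} (hi : i < N) :
    ∃ a ∈ A, ∃ b ∈ A, a.Nonempty ∧ b.Nonempty ∧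
      ∀ x ∈ a, ∀ y ∈ b, x < y ∧ d (x, y) % N = i := by
  classical
  have : NoMaxOrder κ.ord.ToType := Cardinal.noMaxOrder hreg.aleph0_le
  -- A non-fixed pair captured by a family is one level below the rectangle capturing it.
  have hcap : ∀ {A : Set (Finset κ.ord.ToType)}, #A = κ → A.PairwiseDisjoint id →
      ∃ S : Set κ.ord.ToType, (∀ δ, ∃ x ∈ S, δ < x) ∧ ∀ α ∈ S, ∀ β ∈ S, α < β →
        t (α, β) ≠ (α, β) → ∃ a ∈ A, ∃ b ∈ A, a.Nonempty ∧ b.Nonempty ∧ ∀ x ∈ a, ∀ y ∈ b,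
          x < y ∧ t (x, y) ≠ (x, y) ∧ d (x, y) = d (α, β) + 1 := by
    intro A hA hdisj
    obtain ⟨S, hS, h⟩ := ht.capture A hA hdisj
    refine ⟨S, exists_gt_of_isStationary hS, fun α hα β hβ hαβ hne => ?_⟩
    obtain ⟨a, ha, b, hb, hab, himg⟩ := h α hα β hβ hαβ
    have hprod : ((a : Set κ.ord.ToType) ×ˢ (b : Set κ.ord.ToType)).Nonempty := by
      rw [← Set.image_nonempty (f := t), himg]
      exact Set.singleton_nonempty _
    refine ⟨a, ha, b, hb, hprod.fst, hprod.snd, fun x hx y hy => ?_⟩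
    have heq : t (x, y) = (α, β) := himg.subset (Set.mem_image_of_mem t (Set.mk_mem_prod hx hy))
    have hne' : t (x, y) ≠ (x, y) := fun h' => hne (by rw [← heq, h', h'])
    exact ⟨hab x hx y hy, hne', by rw [hd x y (hab x hx y hy) hne', heq]⟩
  by_contra! hcon
  have hstep : ∀ k : ℕ, ∃ S : Set κ.ord.ToType, (∀ δ, ∃ x ∈ S, δ < x) ∧
      ∀ α ∈ S, ∀ β ∈ S, α < β → t (α, β) ≠ (α, β) → (d (α, β) + (k + 1)) % N ≠ i := by
    intro k
    induction k with
    | zero =>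
      obtain ⟨S, hS, h⟩ := hcap hA hdisj
      refine ⟨S, hS, fun α hα β hβ hαβ hne hmod => ?_⟩
      obtain ⟨a, ha, b, hb, ha₀, hb₀, hab⟩ := h α hα β hβ hαβ hne
      obtain ⟨x, hx, y, hy, hxy⟩ := hcon a ha b hb ha₀ hb₀
      obtain ⟨hlt, -, hdxy⟩ := hab x hx y hy
      exact hxy hlt (by rw [hdxy, ← hmod])
    | succ k ih =>
      obtain ⟨S, hS, h⟩ := ih
      obtain ⟨B, hB, hBκ, hBdisj⟩ := exists_pairwiseDisjoint_mk_eq hreg hunc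
        {b | ↑b ⊆ S} fun δ => by
          obtain ⟨x, hx, hδ⟩ := hS δ
          exact ⟨{x}, by simpa using hx, by simp, by simpa using hδ⟩
      obtain ⟨S', hS', h'⟩ := hcap hBκ hBdisj
      refine ⟨S', hS', fun α hα β hβ hαβ hne hmod => ?_⟩
      obtain ⟨a, ha, b, hb, ⟨x, hx⟩, ⟨y, hy⟩, hab⟩ := h' α hα β hβ hαβ hne
      obtain ⟨hlt, hne', hdxy⟩ := hab x hx y hy
      refine h x (hB ha hx) y (hB hb hy) hlt hne' ?_
      rw [hdxy, ← hmod]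
      congr 1
      ring
  choose S hS hSmod using hstep
  obtain ⟨B, hB, hBκ, hBdisj⟩ := exists_pairwiseDisjoint_mk_eq hreg hunc
    {b | ∀ k < N, ∃ x ∈ b, x ∈ S k} fun δ => by
      choose s hsS hδs using fun k => hS k δ
      refine ⟨(Finset.range N).image s, fun k hk => ⟨s k, ?_, hsS k⟩, ⟨s i, ?_⟩, ?_⟩
      · exact Finset.mem_image_of_mem s (Finset.mem_range.2 hk)
      · exact Finset.mem_image_of_mem s (Finset.mem_range.2 hi)
      · simpa using fun k _ => hδs k
  obtain ⟨T, hT, hTcap⟩ := hcap hBκ hBdisj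
  obtain ⟨α, hα, β, hβ, hαβ, hne⟩ := ht.exists_ne hreg hunc hT
  obtain ⟨a, ha, b, hb, -, -, hab⟩ := hTcap α hα β hβ hαβ hne
  obtain ⟨M, rfl⟩ : ∃ M, N = M + 1 := ⟨N - 1, by omega⟩
  -- This `k` is the residue of `i - (d (α, β) + 2)`.
  let k := (i + M * (d (α, β) + 2)) % (M + 1)
  obtain ⟨x, hx, hxS⟩ := hB ha k (Nat.mod_lt _ M.succ_pos)
  obtain ⟨y, hy, hyS⟩ := hB hb k (Nat.mod_lt _ M.succ_pos)
  obtain ⟨hlt, hne', hdxy⟩ := hab x hx y hy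
  refine hSmod k x hxS y hyS hlt hne' ?_
  calc (d (x, y) + (k + 1)) % (M + 1)
      = (d (α, β) + 2 + (i + M * (d (α, β) + 2)) % (M + 1)) % (M + 1) := by
        rw [hdxy]
        congr 1
        simp only [k]
        ring
    _ = (i + (M + 1) * (d (α, β) + 2)) % (M + 1) := by
        rw [Nat.add_mod_mod]
        congr 1
        ring
    _ = i := by rw [Nat.add_mul_mod_self_left, Nat.mod_eq_of_lt hi]

end IsPlOneWitness

theorem exists_rectangular_coloring {κ : Cardinal.{u}} (hreg : κ.IsRegular) (hunc : ℵ₀ < κ)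
    (hpl : PlOne κ) (n : ℕ) :
    ∃ c : κ.ord.ToType → κ.ord.ToType → Fin (n + 1), ∀ A : Set (Finset κ.ord.ToType), #A = κ →
      A.PairwiseDisjoint id → ∀ i, ∃ a ∈ A, ∃ b ∈ A, a.Nonempty ∧ b.Nonempty ∧
        ∀ x ∈ a, ∀ y ∈ b, x < y ∧ c x y = i := by
  obtain ⟨t, ht⟩ := hpl
  obtain ⟨d, hd⟩ := ht.exists_depth
  refine ⟨fun x y => ⟨d (x, y) % (n + 1), Nat.mod_lt _ n.succ_pos⟩, fun A hA hdisj i => ?_⟩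
  simpa only [Fin.ext_iff] using ht.exists_rectangle_depth_mod hreg hunc hd hA hdisj i.isLt

/-! ### The poset of finite sets omitting a color -/

/-- A condition is a color together with a finite set no two elements of which form a pair of
that color. -/
structure OmittingCondition {K C : Type*} [LinearOrder K] (c : K → K → C) where
  /-- The omitted color. -/
  color : C
  /-- The finite set on which the color is omitted. -/
  supp : Finset K
  /-- No pair from `supp` has color `color`. -/
  ne_color : ∀ x ∈ supp, ∀ y ∈ supp, x < y → c x y ≠ color

namespace OmittingCondition

/-- Conditions are extended by enlarging the finite set, the color being kept. Thus the poset is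
the disjoint sum, over the colors `i`, of the posets of finite sets omitting `i`. -/
instance {K C : Type*} [LinearOrder K] (c : K → K → C) : PartialOrder (OmittingCondition c) where
  le p q := p.color = q.color ∧ q.supp ⊆ p.supp
  le_refl p := ⟨rfl, subset_rfl⟩
  le_trans p q r hpq hqr := ⟨hpq.1.trans hqr.1, hqr.2.trans hpq.2⟩
  le_antisymm p q hpq hqp := by
    have hcolor := hpq.1
    have hsupp := hqp.2.antisymm hpq.2
    cases p
    cases q
    simp_all

theorem le_iff {K C : Type*} [LinearOrder K] {c : K → K → C} {p q : OmittingCondition c} :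
    p ≤ q ↔ p.color = q.color ∧ q.supp ⊆ p.supp :=
  Iff.rfl

variable {κ : Cardinal.{u}} {n : ℕ} {c : κ.ord.ToType → κ.ord.ToType → Fin (n + 1)}

theorem not_satisfiesCC (c : κ.ord.ToType → κ.ord.ToType → Fin (n + 1)) :
    ¬ SatisfiesCC κ (Fin (n + 1) → OmittingCondition c) := by
  let e : κ.ord.ToType → Fin (n + 1) → OmittingCondition c := fun α k =>
    ⟨k, {α}, fun x hx y hy hxy => by simp_all⟩
  have he : Function.Injective e := fun α β h =>
    Finset.singleton_injective (congrArg supp (congrFun h 0))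
  have hincomp : ∀ α β : κ.ord.ToType, α < β → ∀ z, ¬ (z ≤ e α ∧ z ≤ e β) := by
    rintro α β hαβ z ⟨hα, hβ⟩
    -- The coordinate whose color is `c α β` prevents a common extension.
    obtain ⟨hcol, hα⟩ := hα (c α β)
    obtain ⟨-, hβ⟩ := hβ (c α β)
    exact (z (c α β)).ne_color α (hα (by simp [e])) β (hβ (by simp [e])) hαβ hcol.symm
  intro hcc
  refine (hcc (Set.range e) ?_).ne (by rw [Cardinal.mk_range_eq e he, Cardinal.mk_ord_toType])
  rintro _ ⟨α, rfl⟩ _ ⟨β, rfl⟩ hne z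
  by_contra! h
  rcases lt_trichotomy α β with hlt | rfl | hlt
  · exact hincomp α β hlt z h
  · exact hne rfl
  · exact hincomp β α hlt z h.symm

theorem satisfiesCC (hreg : κ.IsRegular) (hunc : ℵ₀ < κ)
    (hc : ∀ A : Set (Finset κ.ord.ToType), #A = κ → A.PairwiseDisjoint id →
      ∀ i, ∃ a ∈ A, ∃ b ∈ A, a.Nonempty ∧ b.Nonempty ∧ ∀ x ∈ a, ∀ y ∈ b, x < y ∧ c x y = i) :
    SatisfiesCC κ (Fin n → OmittingCondition c) := by
  classical
  intro A hanti
  by_contra! hA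
  let F : (Fin n → OmittingCondition c) → Finset κ.ord.ToType := fun p =>
    Finset.univ.biUnion fun k => (p k).supp
  have hF : ∀ p k, (p k).supp ⊆ F p := fun p k =>
    Finset.subset_biUnion_of_mem (fun k => (p k).supp) (Finset.mem_univ k)
  obtain ⟨J, hJA, hJ, r, hr⟩ := exists_deltaSystem hreg hunc F A hA
  -- The colors and the traces of the supports on the root take finitely many values.
  let trace : (Fin n → OmittingCondition c) → Fin n → Fin (n + 1) × r.powerset := fun p k =>
    ((p k).color, ⟨(p k).supp ∩ r, Finset.mem_powerset.2 Finset.inter_subset_right⟩)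
  obtain ⟨⟨s⟩, I, hIJ, hI, hs⟩ := Cardinal.infinite_pigeonhole_set
    (fun p : J => ULift.up.{u} (trace p)) κ hJ hreg.aleph0_le
    (by rw [hreg.cof_ord]; exact (Cardinal.lt_aleph0_of_finite _).trans hunc)
  have htrace : ∀ p ∈ I, trace p = s := fun p hp => congrArg ULift.down (hs hp)
  have hcolor : ∀ p ∈ I, ∀ k, (p k).color = (s k).1 := fun p hp k =>
    congrArg Prod.fst (congrFun (htrace p hp) k)
  have hroot : ∀ p ∈ I, ∀ q ∈ I, ∀ k, ∀ x ∈ r, x ∈ (p k).supp → x ∈ (q k).supp := by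
    intro p hp q hq k x hxr hx
    have h : (p k).supp ∩ r = (q k).supp ∩ r := congrArg (fun w => w.2.1)
      (congrFun ((htrace p hp).trans (htrace q hq).symm) k)
    exact (Finset.mem_inter.1 (h ▸ Finset.mem_inter.2 ⟨hx, hxr⟩)).1
  have hinj : Set.InjOn (fun p => F p \ r) I := by
    intro p hp q hq (hpq : F p \ r = F q \ r)
    by_contra hne
    -- Disjoint equal sets are empty, so that `p` and `q` live on the root, where they agree.
    have hdisj : Disjoint (F p \ r) (F q \ r) := hr (hIJ hp) (hIJ hq) hne
    have hq₀ : F q \ r = ∅ := disjoint_self.1 (hpq ▸ hdisj)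
    have hp₀ : F p \ r = ∅ := hpq.trans hq₀
    rw [Finset.sdiff_eq_empty_iff_subset] at hp₀ hq₀
    exact hne (funext fun k => le_antisymm
      (le_iff.2 ⟨(hcolor p hp k).trans (hcolor q hq k).symm,
        fun x hx => hroot q hq p hp k x (hq₀ (hF q k hx)) hx⟩)
      (le_iff.2 ⟨(hcolor q hq k).trans (hcolor p hp k).symm,
        fun x hx => hroot p hp q hq k x (hp₀ (hF p k hx)) hx⟩))
  obtain ⟨I', hI'I, hI'⟩ := Cardinal.le_mk_iff_exists_subset.1 hI
  -- Only `n` of the `n + 1` colors can occur.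
  obtain ⟨i, hi⟩ : ∃ i, ∀ k, (s k).1 ≠ i := by
    by_contra! h
    have := Fintype.card_le_of_surjective (fun k => (s k).1) h
    simp at this
  obtain ⟨_, ⟨p, hp', rfl⟩, _, ⟨q, hq', rfl⟩, ⟨x₀, hx₀⟩, ⟨y₀, hy₀⟩, hpq⟩ :=
    hc ((fun p => F p \ r) '' I') (by rw [Cardinal.mk_image_eq_of_injOn _ _ (hinj.mono hI'I), hI'])
      ((hinj.mono hI'I).pairwiseDisjoint_image.2 (hr.subset (hI'I.trans hIJ))) i
  have hp := hI'I hp'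
  have hq := hI'I hq'
  have hne : p ≠ q := by
    rintro rfl
    exact lt_asymm (hpq x₀ hx₀ y₀ hy₀).1 (hpq y₀ hy₀ x₀ hx₀).1
  -- A pair from the union of the supports lies in one of the supports or has color `i`.
  let z : Fin n → OmittingCondition c := fun k =>
    { color := (s k).1
      supp := (p k).supp ∪ (q k).supp
      ne_color := by
        intro x hx y hy hxy
        have hpk := (p k).ne_color
        have hqk := (q k).ne_color
        rw [hcolor p hp k] at hpk
        rw [hcolor q hq k] at hqk
        by_cases hxr : x ∈ r
        · rcases Finset.mem_union.1 hy with hy | hy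
          · refine hpk x ?_ y hy hxy
            exact (Finset.mem_union.1 hx).elim id (hroot q hq p hp k x hxr)
          · refine hqk x ?_ y hy hxy
            exact (Finset.mem_union.1 hx).elim (hroot p hp q hq k x hxr) id
        by_cases hyr : y ∈ r
        · rcases Finset.mem_union.1 hx with hx | hx
          · refine hpk x hx y ?_ hxy
            exact (Finset.mem_union.1 hy).elim id (hroot q hq p hp k y hyr)
          · refine hqk x hx y ?_ hxy
            exact (Finset.mem_union.1 hy).elim (hroot p hp q hq k y hyr) id
        have hF' : ∀ p : Fin n → OmittingCondition c, ∀ w ∈ (p k).supp, w ∉ r → w ∈ F p \ r :=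
          fun p w hw hwr => Finset.mem_sdiff.2 ⟨hF p k hw, hwr⟩
        rcases Finset.mem_union.1 hx with hx | hx <;> rcases Finset.mem_union.1 hy with hy | hy
        · exact hpk x hx y hy hxy
        · rw [(hpq x (hF' p x hx hxr) y (hF' q y hy hyr)).2]
          exact (hi k).symm
        · exact absurd (hpq y (hF' p y hy hyr) x (hF' q x hx hxr)).1 hxy.not_gt
        · exact hqk x hx y hy hxy }
  rcases hanti (hJA (hIJ hp)) (hJA (hIJ hq)) hne z with h | h
  · exact h fun k => ⟨(hcolor p hp k).symm, Finset.subset_union_left⟩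
  · exact h fun k => ⟨(hcolor q hq k).symm, Finset.subset_union_right⟩

end OmittingCondition

theorem theoremB (κ : Cardinal.{u}) (hreg : κ.IsRegular) (hunc : ℵ₀ < κ) (hpl : PlOne κ)
    (n : ℕ) (hn : 0 < n) :
    ∃ (P : Type u) (_ : PartialOrder P),
      SatisfiesCC κ (Fin n → P) ∧ ¬ SatisfiesCC κ (Fin (n + 1) → P) := by
  obtain ⟨c, hc⟩ := exists_rectangular_coloring hreg hunc hpl n
  exact ⟨OmittingCondition c, inferInstance, OmittingCondition.satisfiesCC hreg hunc hc,
    OmittingCondition.not_satisfiesCC c⟩
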